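/- **Setting.** A *$*$-algebroid* $\mathcal A$ over $\mathbb C$ with object set $S$ consists of complex vector spaces $\mathcal A_s^t$ ($s,t\in S$; domain $s$, codomain $t$), associative bilinear products $\mathcal A_u^t\times\mathcal A_s^u\to\mathcal A_s^t$, $(a,b)\mapsto ab$, and conjugate-linear maps $*\colon\mathcal A_s^t\to\mathcal A_t^s$ with $(ab)^*=b^*a^*$ and $a^{**}=a$. It is a *$B^*$-algebroid* if each $\mathcal A_s^t$ is a Banach space, $\|ab\|\le\|a\|\,\|b\|$ and $\|a^*\|=\|a\|$. A *unit* is a family $e_s\in\mathcal A_s^s$ with $e_ta=a=ae_s$ for all $a\in\mathcal A_s^t$. An element of $\mathcal A_s^s$ is *positive* if it is a finite sum of elements $x^*x$ with $x\in\mathcal A_s^t$, $t\in S$ arbitrary. For $n\in\mathbb N$ the *amplification* ${}^n\!\mathcal A$ is the $*$-algebroid with object set $S^n$ in which $({}^n\!\mathcal A)_{\mathbf s}^{\mathbf t}$ consists of the matrices $[a_{ij}]_{i,j=1}^n$ with $a_{ij}\in\mathcal A_{s_j}^{t_i}$, with matrix multiplication and $[a_{ij}]^*=[a_{ji}^*]$.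 For a family $\mathbf H=\{\mathcal H_x\}_{x\in X}$ of complex Hilbert spaces, $\mathcal B(\mathbf H)$ is the $*$-algebroid with object set $X$ and fibres $\mathcal B(\mathcal H_x,\mathcal H_y)$. Let $\mathcal A$ be a $B^*$-algebroid with unit $e$ and object set $S$, $\mathbf H=\{\mathcal H_x\}_{x\in X}$ a family of complex Hilbert spaces, $\tau\colon S\to X$ a map, and $T\colon\mathcal A\to\mathcal B(\mathbf H)$ a map that is $\tau$-coherent ($T$ maps $\mathcal A_s^t$ into $\mathcal B(\mathcal H_{\tau(s)},\mathcal H_{\tau(t)})$), linear on each $\mathcal A_s^t$, and Hermitian ($T(a^*)=T(a)^*$). * $T$ is *completely positive* if, for all $n$ and $\mathbf s\in S^n$, the entrywise map $[a_{ij}]\mapsto[T(a_{ij})]$ sends positive elements of $({}^n\!\mathcal A)_{\mathbf s}^{\mathbf s}$ to positive elements of ${}^n\mathcal B(\mathbf H)$. * $T$ is *partially positive semidefinite* if $\sum_{i,j=1}^n\langle T(a_i^*a_j)h_j,h_i\rangle\ge0$ for all $n$, all $s,s_1,\dots,s_n\in S$, $a_i\in\mathcal A_{s_i}^s$ and $h_i\in\mathcal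 H_{\tau(s_i)}$. * A *dilation* $(\mathbf K;\mathbf V;\Phi)$ of $T$ consists of a family $\mathbf K=\{\mathcal K_x\}_{x\in X}$ of Hilbert spaces, operators $V_s\in\mathcal B(\mathcal H_{\tau(s)},\mathcal K_{\tau(s)})$ $(s\in S)$, and linear maps $\Phi\colon\mathcal A_s^t\to\mathcal B(\mathcal K_{\tau(s)},\mathcal K_{\tau(t)})$ with $\Phi(ab)=\Phi(a)\Phi(b)$ (for composable $a,b$), $\Phi(a^*)=\Phi(a)^*$ and $T(a)=V_t^*\Phi(a)V_s$ for $a\in\mathcal A_s^t$. It is *orthogonal* if $\operatorname{ran}\Phi(a)\perp\operatorname{ran}\Phi(b)$ whenever $a\in\mathcal A_u^s$, $b\in\mathcal A_v^t$, $s\ne t$ and $\tau(s)=\tau(t)$; *minimal* if, for each $x\in X$, $\mathcal K_x$ is the closed linear span of all $\Phi(a)V_s\mathcal H_{\tau(s)}$ with $a\in\mathcal A_s^t$ and $\tau(t)=x$; *unit-supported* if $\Phi(e_s)V_s=V_s$ for all $s\in S$. * Two dilations $(\mathbf K;\mathbf V;\Phi)$ and $(\mathbf K';\mathbf V';\Phi')$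 are *unitarily equivalent* if there are unitaries $U_x\colon\mathcal K_x\to\mathcal K_x'$ $(x\in X)$ with $U_{\tau(t)}\Phi(a)=\Phi'(a)U_{\tau(s)}$ for all $a\in\mathcal A_s^t$ and $U_{\tau(s)}V_s=V'_s$ for all $s\in S$. **Theorem.** The following are equivalent: (1) $T$ is completely positive; (2) $T$ is partially positive semidefinite; (3) $T$ has a dilation. In addition, if $T$ has a dilation, then it has one that is orthogonal, minimal and unit-supported. Moreover, let $(\mathbf K;\mathbf V;\Phi)$ and $(\mathbf K';\mathbf V';\Phi')$ be any two orthogonal minimal dilations of $T$. Then there are unitaries $U_x\colon\mathcal K_x\to\mathcal K'_x$ $(x\in X)$ with $U_{\tau(t)}\Phi(a)=\Phi'(a)U_{\tau(s)}$ for all $a\in\mathcal A_s^t$ and $U_{\tau(s)}\Phi(e_s)V_s=\Phi'(e_s)V'_s$ for all $s\in S$. In particular, if both dilations are unit-supported, or if $\tau$ is injective, then they are unitarily equivalent. -/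

import Mathlib

universe uS uA uX uB uH w w'

/-- A `*`-algebroid over `ℂ` with object set `S`. The fibre `A s t` consists of the elements with
domain `s` and codomain `t`, so that `mul a b` (the product `ab`) is defined when the domain of `a`
is the codomain of `b`. -/
structure StarAlgebroid (S : Type uS) (A : S → S → Type uA)
    [∀ s t, AddCommGroup (A s t)] [∀ s t, Module ℂ (A s t)] where
  mul : ∀ {s u t : S}, A u t → A s u → A s t
  star : ∀ {s t : S}, A s t → A t s
  mul_assoc : ∀ {s u v t : S} (a : A v t) (b : A u v) (c : A s u),
    mul a (mul b c) = mul (mul a b) c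
  mul_add : ∀ {s u t : S} (a : A u t) (b c : A s u), mul a (b + c) = mul a b + mul a c
  add_mul : ∀ {s u t : S} (a b : A u t) (c : A s u), mul (a + b) c = mul a c + mul b c
  mul_smul : ∀ {s u t : S} (z : ℂ) (a : A u t) (b : A s u), mul a (z • b) = z • mul a b
  smul_mul : ∀ {s u t : S} (z : ℂ) (a : A u t) (b : A s u), mul (z • a) b = z • mul a b
  star_mul : ∀ {s u t : S} (a : A u t) (b : A s u), star (mul a b) = mul (star b) (star a)
  star_star : ∀ {s t : S} (a : A s t), star (star a) = a
  star_add : ∀ {s t : S} (a b : A s t), star (a + b) = star a + star b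
  star_smul : ∀ {s t : S} (z : ℂ) (a : A s t), star (z • a) = (starRingEnd ℂ z) • star a

/-- A `B*`-algebroid: the fibres are Banach spaces, the norms are submultiplicative and the
involution is isometric. -/
structure BStarAlgebroid (S : Type uS) (A : S → S → Type uA)
    [∀ s t, NormedAddCommGroup (A s t)] [∀ s t, NormedSpace ℂ (A s t)]
    extends StarAlgebroid S A where
  complete : ∀ s t, CompleteSpace (A s t)
  norm_mul_le : ∀ {s u t : S} (a : A u t) (b : A s u), ‖mul a b‖ ≤ ‖a‖ * ‖b‖
  norm_star : ∀ {s t : S} (a : A s t), ‖star a‖ = ‖a‖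

namespace StarAlgebroid

section General

variable {S : Type uS} {A : S → S → Type uA}
  [∀ s t, AddCommGroup (A s t)] [∀ s t, Module ℂ (A s t)]
  {X : Type uX} {B : X → X → Type uB}
  [∀ x y, AddCommGroup (B x y)] [∀ x y, Module ℂ (B x y)]

/-- The family `e` is the unit of the algebroid. -/
structure IsUnit (M : StarAlgebroid S A) (e : ∀ s, A s s) : Prop where
  one_mul : ∀ {s t : S} (a : A s t), M.mul (e t) a = a
  mul_one : ∀ {s t : S} (a : A s t), M.mul a (e s) = a

/-- Positive elements: finite sums of elements `x* x`, where each `x` has domain `s` and an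
arbitrary codomain. -/
def IsPositive (M : StarAlgebroid S A) {s : S} (a : A s s) : Prop :=
  ∃ (m : ℕ) (t : Fin m → S) (x : ∀ k, A s (t k)), a = ∑ k, M.mul (M.star (x k)) (x k)

theorem mul_sum (M : StarAlgebroid S A) {ι : Type*} (I : Finset ι) {s u t : S}
    (a : A u t) (f : ι → A s u) : M.mul a (∑ i ∈ I, f i) = ∑ i ∈ I, M.mul a (f i) :=
  map_sum (AddMonoidHom.mk' (M.mul (s := s) a) (M.mul_add a)) f I

theorem sum_mul (M : StarAlgebroid S A) {ι : Type*} (I : Finset ι) {s u t : S}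
    (f : ι → A u t) (a : A s u) : M.mul (∑ i ∈ I, f i) a = ∑ i ∈ I, M.mul (f i) a :=
  map_sum (AddMonoidHom.mk' (fun b : A u t => M.mul b a) (fun b c => M.add_mul b c a)) f I

theorem star_sum (M : StarAlgebroid S A) {ι : Type*} (I : Finset ι) {s t : S}
    (f : ι → A s t) : M.star (∑ i ∈ I, f i) = ∑ i ∈ I, M.star (f i) :=
  map_sum (AddMonoidHom.mk' (M.star (s := s) (t := t)) M.star_add) f I

/-- The `n`-fold amplification. Its objects are `n`-tuples of objects, the fibre from `s` to `t`
consists of the matrices `a` with `a i j ∈ A (s j) (t i)`, the product is the matrix product and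
the involution is transposition combined with the entrywise involution. -/
def amplification (M : StarAlgebroid S A) (n : ℕ) :
    StarAlgebroid (Fin n → S) (fun s t => ∀ i j : Fin n, A (s j) (t i)) where
  mul a b := fun i j => ∑ k, M.mul (a i k) (b k j)
  star a := fun i j => M.star (a j i)
  mul_assoc a b c := by
    funext i j
    simp only [M.mul_sum, M.sum_mul, M.mul_assoc]
    exact Finset.sum_comm
  mul_add a b c := by
    funext i j
    simp only [Pi.add_apply, M.mul_add, Finset.sum_add_distrib]
  add_mul a b c := by
    funext i j
    simp only [Pi.add_apply, M.add_mul, Finset.sum_add_distrib]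
  mul_smul z a b := by
    funext i j
    simp only [Pi.smul_apply, M.mul_smul, Finset.smul_sum]
  smul_mul z a b := by
    funext i j
    simp only [Pi.smul_apply, M.smul_mul, Finset.smul_sum]
  star_mul a b := by
    funext i j
    simp only [M.star_sum, M.star_mul]
  star_star a := by
    funext i j
    simp only [M.star_star]
  star_add a b := by
    funext i j
    simp only [Pi.add_apply, M.star_add]
  star_smul z a := by
    funext i j
    simp only [Pi.smul_apply, M.star_smul]

/-- A (fibrewise linear) `τ`-coherent map `T` is Hermitian. -/
def IsHermitianMap (M : StarAlgebroid S A) (N : StarAlgebroid X B) {τ : S → X}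
    (T : ∀ s t, A s t →ₗ[ℂ] B (τ s) (τ t)) : Prop :=
  ∀ (s t : S) (a : A s t), T t s (M.star a) = N.star (T s t a)

/-- `T` is `n`-positive: it is Hermitian and its entrywise amplification maps the positive elements
of the `n`-fold amplification of the source to positive elements of that of the target. -/
def IsNPositive (M : StarAlgebroid S A) (N : StarAlgebroid X B) {τ : S → X}
    (T : ∀ s t, A s t →ₗ[ℂ] B (τ s) (τ t)) (n : ℕ) : Prop :=
  IsHermitianMap M N T ∧
    ∀ (s : Fin n → S) (a : ∀ i j : Fin n, A (s j) (s i)),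
      (M.amplification n).IsPositive (s := s) a →
        (N.amplification n).IsPositive (s := fun i => τ (s i))
          (fun i j => T (s j) (s i) (a i j))

/-- `T` is completely positive. -/
def IsCompletelyPositive (M : StarAlgebroid S A) (N : StarAlgebroid X B) {τ : S → X}
    (T : ∀ s t, A s t →ₗ[ℂ] B (τ s) (τ t)) : Prop :=
  ∀ n : ℕ, IsNPositive M N T n

/-- `*`-morphisms of `*`-algebroids whose map between the objects is `τ`. -/
structure StarMorphism (M : StarAlgebroid S A) (N : StarAlgebroid X B) (τ : S → X) where
  map : ∀ s t, A s t →ₗ[ℂ] B (τ s) (τ t)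
  map_mul : ∀ {s u t : S} (a : A u t) (b : A s u),
    map s t (M.mul a b) = N.mul (map u t a) (map s u b)
  map_star : ∀ {s t : S} (a : A s t), map t s (M.star a) = N.star (map s t a)

end General

/-- The `*`-algebroid `𝓑(𝐇)` of all bounded operators between the members of a bundle of Hilbert
spaces. -/
noncomputable def boundedOperators {X : Type uX} (H : X → Type uH)
    [∀ x, NormedAddCommGroup (H x)] [∀ x, InnerProductSpace ℂ (H x)] [∀ x, CompleteSpace (H x)] :
    StarAlgebroid X (fun x y => H x →L[ℂ] H y) where
  mul a b := a ∘L b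
  star a := ContinuousLinearMap.adjoint a
  mul_assoc _ _ _ := rfl
  mul_add a b c := ContinuousLinearMap.comp_add a b c
  add_mul a b c := ContinuousLinearMap.add_comp a b c
  mul_smul z a b := ContinuousLinearMap.comp_smul a z b
  smul_mul z a b := ContinuousLinearMap.smul_comp z a b
  star_mul a b := ContinuousLinearMap.adjoint_comp a b
  star_star a := ContinuousLinearMap.adjoint_adjoint a
  star_add a b := map_add _ a b
  star_smul z a := map_smulₛₗ _ z a

section Hilbert

open scoped ComplexOrder

variable {S : Type uS} {A : S → S → Type uA}
  [∀ s t, AddCommGroup (A s t)] [∀ s t, Module ℂ (A s t)]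
  {X : Type uX} {H : X → Type uH}
  [∀ x, NormedAddCommGroup (H x)] [∀ x, InnerProductSpace ℂ (H x)]

/-- `T` is partially positive semidefinite: `∑ ⟨T(aᵢ* aⱼ) hⱼ, hᵢ⟩ ≥ 0` for all finite families
`aᵢ` with a common codomain and all vectors `hᵢ`. -/
def IsPartiallyPosSemidef (M : StarAlgebroid S A) {τ : S → X}
    (T : ∀ s t, A s t →ₗ[ℂ] (H (τ s) →L[ℂ] H (τ t))) : Prop :=
  ∀ (n : ℕ) (s : S) (t : Fin n → S) (a : ∀ i, A (t i) s) (h : ∀ i, H (τ (t i))),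
    (0 : ℂ) ≤ ∑ i, ∑ j, inner ℂ (h i) (T (t j) (t i) (M.mul (M.star (a i)) (a j)) (h j))

variable [∀ x, CompleteSpace (H x)]

/-- A (bounded) dilation `(𝐊; 𝐕; Φ)` of `T`: a bundle `K` of Hilbert spaces, a `*`-representation
`Φ` on it with aggregation map `τ`, and bounded operators `V s`, with
`T(a) = (V t)* Φ(a) (V s)` for `a` in the fibre from `s` to `t`. -/
structure Dilation (M : StarAlgebroid S A) {τ : S → X}
    (T : ∀ s t, A s t →ₗ[ℂ] (H (τ s) →L[ℂ] H (τ t))) where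
  K : X → Type w
  [normedK : ∀ x, NormedAddCommGroup (K x)]
  [innerK : ∀ x, InnerProductSpace ℂ (K x)]
  [completeK : ∀ x, CompleteSpace (K x)]
  V : ∀ s, H (τ s) →L[ℂ] K (τ s)
  Φ : StarMorphism M (boundedOperators K) τ
  eq_compression : ∀ (s t : S) (a : A s t),
    T s t a = ContinuousLinearMap.adjoint (V t) ∘L (Φ.map s t a ∘L V s)

end Hilbert

end StarAlgebroid

attribute [instance] StarAlgebroid.Dilation.normedK
attribute [instance] StarAlgebroid.Dilation.innerK
attribute [instance] StarAlgebroid.Dilation.completeK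

namespace StarAlgebroid.Dilation

/-- The identification of the fibres of a bundle over equal points. -/
def fibreCast {X : Type uX} (K : X → Type w) {x y : X} (h : x = y) (v : K x) : K y := h ▸ v

variable {S : Type uS} {A : S → S → Type uA}
  [∀ s t, AddCommGroup (A s t)] [∀ s t, Module ℂ (A s t)]
  {X : Type uX} {H : X → Type uH}
  [∀ x, NormedAddCommGroup (H x)] [∀ x, InnerProductSpace ℂ (H x)] [∀ x, CompleteSpace (H x)]
  {M : StarAlgebroid S A} {τ : S → X} {T : ∀ s t, A s t →ₗ[ℂ] (H (τ s) →L[ℂ] H (τ t))}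

/-- The operator `Φ(a)` of the `*`-representation of a dilation. -/
abbrev op (D : Dilation.{uS, uA, uX, uH, w} M T) {s t : S} (a : A s t) :
    D.K (τ s) →L[ℂ] D.K (τ t) := D.Φ.map s t a

/-- Orthogonality: `Φ(a)` and `Φ(b)` have orthogonal ranges whenever the codomains of `a` and `b`
are distinct objects with the same image under `τ`. -/
def IsOrthogonal (D : Dilation.{uS, uA, uX, uH, w} M T) : Prop :=
  ∀ (u v s t : S) (a : A u s) (b : A v t), s ≠ t → ∀ hst : τ s = τ t,
    ∀ (k : D.K (τ u)) (l : D.K (τ v)),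
      inner ℂ (fibreCast D.K hst (D.op a k)) (D.op b l) = 0

/-- Minimality: each `K x` is the closed linear span of the ranges of the operators `Φ(a) (V s)`,
over all `a` with domain `s` whose codomain is mapped to `x`. -/
def IsMinimal (D : Dilation.{uS, uA, uX, uH, w} M T) : Prop :=
  ∀ x : X, (Submodule.span ℂ {v : D.K x | ∃ (s t : S) (hx : τ t = x) (a : A s t) (h : H (τ s)),
    v = fibreCast D.K hx (D.op a (D.V s h))}).topologicalClosure = ⊤

/-- `Φ(eₛ) (V s) = V s` for every object `s`, where `e` is the unit. -/
def IsUnitSupported (D : Dilation.{uS, uA, uX, uH, w} M T) (e : ∀ s, A s s) : Prop :=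
  ∀ (s : S) (h : H (τ s)), D.op (e s) (D.V s h) = D.V s h

/-- The bundle of unitary operators `U` intertwines the `*`-representations of two dilations. -/
def Intertwines (D : Dilation.{uS, uA, uX, uH, w} M T) (D' : Dilation.{uS, uA, uX, uH, w'} M T)
    (U : ∀ x, D.K x ≃ₗᵢ[ℂ] D'.K x) : Prop :=
  ∀ (s t : S) (a : A s t) (k : D.K (τ s)), U (τ t) (D.op a k) = D'.op a (U (τ s) k)

/-- Unitary equivalence of dilations. -/
def UnitarilyEquivalent (D : Dilation.{uS, uA, uX, uH, w} M T)
    (D' : Dilation.{uS, uA, uX, uH, w'} M T) : Prop :=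
  ∃ U : ∀ x, D.K x ≃ₗᵢ[ℂ] D'.K x, D.Intertwines D' U ∧
    ∀ (s : S) (h : H (τ s)), U (τ s) (D.V s h) = D'.V s h

end StarAlgebroid.Dilation

/-! ### Hilbert spaces generated by families of vectors -/

namespace HilbertFamily

open Finsupp ComplexConjugate

variable {ι : Type*} {E F G : Type*}
  [NormedAddCommGroup E] [InnerProductSpace ℂ E]
  [NormedAddCommGroup F] [InnerProductSpace ℂ F]
  [NormedAddCommGroup G] [InnerProductSpace ℂ G]

/-! (1) implies (2) because `[aᵢ* aⱼ]` is `x* x` for a matrix `x` with the single nonzero row `(a₁,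
…, aₙ)`. (3) implies (1) because a `*`-representation, applied entrywise, preserves squares,
compression by `V` preserves nonnegative quadratic forms, and a matrix over `𝓑(𝐇)` with nonnegative
form is a positive operator on a finite Hilbert sum, hence a square (`isPositive_of_inner_nonneg`).

(2) implies (3) is a GNS–Stinespring construction, done for each object `t` separately. Partial
positivity says that `((a, h), (b, k)) ↦ ⟨T(a* b) k, h⟩` is a positive semidefinite kernel on pairs
with codomain `t`, so it is the Gram matrix of vectors `a ⊗ h` in a Hilbert space `G t`
(`nonempty_gramRealization`). Left multiplication by `c` is bounded because `e - c* c = y* y` when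
`‖c‖ < 1` (`exists_sub_star_mul_self_eq`). The fibre `K x` is the Hilbert sum of the `G t` with `τ t
= x`, and `V s h = e_s ⊗ h`; different objects occupy orthogonal summands.

For uniqueness, the inner products of the generators `Φ(a) V_s h` are given by `T` when the
codomains agree and vanish by orthogonality otherwise (`inner_gen_eq`). Two orthogonal minimal
dilations thus have dense generating families with equal Gram matrices, which yields the unitaries.
-/

theorem inner_linearCombination (v w : ι → E) (z y : ι →₀ ℂ) :
    inner ℂ (linearCombination ℂ v z) (linearCombination ℂ w y) =
      z.sum fun i a => y.sum fun j b => conj a * b * inner ℂ (v i) (w j) := by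
  simp only [linearCombination_apply, Finsupp.sum]
  rw [sum_inner]
  refine Finset.sum_congr rfl fun i _ => ?_
  rw [inner_sum]
  refine Finset.sum_congr rfl fun j _ => ?_
  rw [inner_smul_left, inner_smul_right, mul_assoc]

/-- If the Gram matrix of `v` is the sum of those of `w` and `u`, then the squared norms of linear
combinations add up as well. -/
theorem norm_sq_linearCombination_of_gram_add {v : ι → E} {w : ι → F} {u : ι → G}
    (h : ∀ i j, inner ℂ (v i) (v j) = inner ℂ (w i) (w j) + inner ℂ (u i) (u j)) (z : ι →₀ ℂ) :
    ‖linearCombination ℂ v z‖ ^ 2 =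
      ‖linearCombination ℂ w z‖ ^ 2 + ‖linearCombination ℂ u z‖ ^ 2 := by
  rw [norm_sq_eq_re_inner (𝕜 := ℂ), norm_sq_eq_re_inner (𝕜 := ℂ), norm_sq_eq_re_inner (𝕜 := ℂ),
    ← map_add]
  simp only [inner_linearCombination, h, mul_add, Finsupp.sum, Finset.sum_add_distrib]

theorem norm_linearCombination_eq_of_gram_eq {v : ι → E} {w : ι → F}
    (h : ∀ i j, inner ℂ (v i) (v j) = inner ℂ (w i) (w j)) (z : ι →₀ ℂ) :
    ‖linearCombination ℂ v z‖ = ‖linearCombination ℂ w z‖ := by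
  have := norm_sq_linearCombination_of_gram_add (u := fun _ => (0 : ℂ)) (v := v) (w := w)
    (by simpa using h) z
  rw [← sq_eq_sq₀ (norm_nonneg _) (norm_nonneg _), this]
  simp [linearCombination_apply]

theorem denseRange_linearCombination {v : ι → E}
    (hv : (Submodule.span ℂ (Set.range v)).topologicalClosure = ⊤) :
    DenseRange (linearCombination ℂ v) := by
  rw [DenseRange, ← LinearMap.coe_range, range_linearCombination]
  exact Submodule.dense_iff_topologicalClosure_eq_top.2 hv

/-- A bounded operator is determined by its values on a family with dense span. -/
theorem clm_ext {v : ι → E} (hv : (Submodule.span ℂ (Set.range v)).topologicalClosure = ⊤)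
    {f g : E →L[ℂ] F} (h : ∀ i, f (v i) = g (v i)) : f = g :=
  ContinuousLinearMap.ext_on (Submodule.dense_iff_topologicalClosure_eq_top.2 hv)
    (by rintro _ ⟨i, rfl⟩; exact h i)

theorem eq_of_inner {v : ι → E}
    (hv : (Submodule.span ℂ (Set.range v)).topologicalClosure = ⊤) {x y : E}
    (h : ∀ i, inner ℂ (v i) x = inner ℂ (v i) y) : x = y := by
  have : innerSL ℂ x = innerSL ℂ y := clm_ext hv fun i => by
    rw [innerSL_apply_apply, innerSL_apply_apply, ← inner_conj_symm, h i, inner_conj_symm]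
  exact (innerSL_inj (𝕜 := ℂ)).1 this

/-- The bound on all linear combinations makes `v i ↦ w i` respect the linear relations among the `v
i`, so it is well defined and bounded on a dense subspace. -/
theorem exists_clm [CompleteSpace F] {v : ι → E}
    (hv : (Submodule.span ℂ (Set.range v)).topologicalClosure = ⊤) {w : ι → F} {C : ℝ}
    (h : ∀ z, ‖linearCombination ℂ w z‖ ≤ C * ‖linearCombination ℂ v z‖) :
    ∃ f : E →L[ℂ] F, ∀ i, f (v i) = w i := by
  refine ⟨(linearCombination ℂ w).extendOfNorm (linearCombination ℂ v), fun i => ?_⟩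
  simpa using LinearMap.extendOfNorm_eq (f := linearCombination ℂ w)
    (denseRange_linearCombination hv) ⟨C, h⟩ (single i 1)

/-- Two families with dense spans and equal Gram matrices are unitarily equivalent. -/
theorem exists_unitary [CompleteSpace E] [CompleteSpace F] {v : ι → E} {w : ι → F}
    (hv : (Submodule.span ℂ (Set.range v)).topologicalClosure = ⊤)
    (hw : (Submodule.span ℂ (Set.range w)).topologicalClosure = ⊤)
    (h : ∀ i j, inner ℂ (v i) (v j) = inner ℂ (w i) (w j)) :
    ∃ U : E ≃ₗᵢ[ℂ] F, ∀ i, U (v i) = w i := by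
  refine ⟨(LinearEquiv.refl ℂ (ι →₀ ℂ)).extendOfIsometry (linearCombination ℂ v)
    (linearCombination ℂ w) (denseRange_linearCombination hv) (denseRange_linearCombination hw)
    fun z => (norm_linearCombination_eq_of_gram_eq h z).symm, fun i => ?_⟩
  simpa using LinearEquiv.extendOfIsometry_eq (LinearEquiv.refl ℂ (ι →₀ ℂ))
    (linearCombination ℂ v)
    (linearCombination ℂ w) (denseRange_linearCombination hv) (denseRange_linearCombination hw)
    (fun z => (norm_linearCombination_eq_of_gram_eq h z).symm) (single i 1)

end HilbertFamily

/-! ### Hilbert spaces realizing positive semidefinite kernels -/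

/-- A family of vectors with dense span in a Hilbert space, with prescribed Gram matrix. -/
structure GramRealization {ι : Type w} (k : ι → ι → ℂ) where
  space : Type w
  [normedSpace : NormedAddCommGroup space]
  [innerSpace : InnerProductSpace ℂ space]
  [completeSpace : CompleteSpace space]
  vec : ι → space
  inner_vec : ∀ i j, inner ℂ (vec i) (vec j) = k i j
  dense : (Submodule.span ℂ (Set.range vec)).topologicalClosure = ⊤

attribute [instance] GramRealization.normedSpace
attribute [instance] GramRealization.innerSpace
attribute [instance] GramRealization.completeSpace

open ComplexConjugate in
/-- The semi-inner product on the free vector space over `ι` defined by a positive semidefinite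
kernel. -/
@[reducible]
noncomputable def gramCore {ι : Type w} (k : ι → ι → ℂ) (hk : ∀ i j, conj (k i j) = k j i)
    (hpos : ∀ z : ι →₀ ℂ, 0 ≤ (z.sum fun i a => z.sum fun j b => conj a * b * k i j).re) :
    PreInnerProductSpace.Core ℂ (ι →₀ ℂ) where
  inner z y := z.sum fun i a => y.sum fun j b => conj a * b * k i j
  conj_inner_symm z y := by
    rw [Finsupp.sum_comm]
    simp only [map_finsuppSum, map_mul, hk, Complex.conj_conj]
    congr! 5
    funext b
    ring
  re_inner_nonneg := hpos
  add_left _ _ _ := by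
    rw [Finsupp.sum_add_index'] <;> simp [← Finsupp.sum_add, add_mul]
  smul_left _ _ _ := by
    rw [Finsupp.sum_smul_index] <;> simp [Finsupp.mul_sum, ← mul_assoc]

open ComplexConjugate in
/-- Kolmogorov's theorem: a positive semidefinite kernel is a Gram matrix. -/
theorem nonempty_gramRealization {ι : Type w} (k : ι → ι → ℂ) (hk : ∀ i j, conj (k i j) = k j i)
    (hpos : ∀ z : ι →₀ ℂ, 0 ≤ (z.sum fun i a => z.sum fun j b => conj a * b * k i j).re) :
    Nonempty (GramRealization k) := by
  -- The form may be degenerate; the Hausdorff completion below also divides out its null vectors.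
  let _ : SeminormedAddCommGroup (ι →₀ ℂ) :=
    InnerProductSpace.Core.toSeminormedAddCommGroup (c := gramCore k hk hpos)
  let _ : InnerProductSpace ℂ (ι →₀ ℂ) := InnerProductSpace.ofCore (gramCore k hk hpos)
  refine ⟨{
    space := UniformSpace.Completion (ι →₀ ℂ)
    vec := fun i => ((Finsupp.single i 1 : ι →₀ ℂ) : UniformSpace.Completion (ι →₀ ℂ))
    inner_vec := fun i j => ?_
    dense := ?_ }⟩
  · rw [UniformSpace.Completion.inner_coe]
    change Finsupp.sum _ _ = _
    simp
  · rw [← Submodule.dense_iff_topologicalClosure_eq_top]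
    refine UniformSpace.Completion.denseRange_coe.mono ?_
    rintro _ ⟨z, rfl⟩
    have hz : z ∈ Submodule.span ℂ (Set.range fun i => (Finsupp.single i 1 : ι →₀ ℂ)) := by
      rw [← Finsupp.coe_basisSingleOne, Module.Basis.span_eq]
      trivial
    have := Submodule.mem_map_of_mem
      (f := (UniformSpace.Completion.toComplL (𝕜 := ℂ) (E := ι →₀ ℂ)).toLinearMap) hz
    rw [Submodule.map_span, ← Set.range_comp] at this
    exact this

/-! ### Algebraic identities and square roots in `B*`-algebroids -/

namespace StarAlgebroid

section Algebra

variable {S : Type uS} {A : S → S → Type uA}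
  [∀ s t, AddCommGroup (A s t)] [∀ s t, Module ℂ (A s t)] (M : StarAlgebroid S A)

theorem mul_zero {s u t : S} (a : A u t) : M.mul a (0 : A s u) = 0 := by
  simpa using M.mul_smul 0 a (0 : A s u)

theorem star_zero {s t : S} : M.star (0 : A s t) = 0 := by
  simpa using M.star_smul 0 (0 : A s t)

theorem mul_sub {s u t : S} (a : A u t) (b c : A s u) :
    M.mul a (b - c) = M.mul a b - M.mul a c := by
  rw [eq_sub_iff_add_eq, ← M.mul_add, sub_add_cancel]

theorem sub_mul {s u t : S} (a b : A u t) (c : A s u) :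
    M.mul (a - b) c = M.mul a c - M.mul b c := by
  rw [eq_sub_iff_add_eq, ← M.add_mul, sub_add_cancel]

theorem star_sub {s t : S} (a b : A s t) : M.star (a - b) = M.star a - M.star b := by
  rw [eq_sub_iff_add_eq, ← M.star_add, sub_add_cancel]

variable {M} in
theorem IsUnit.star_eq {e : ∀ s, A s s} (he : M.IsUnit e) (s : S) : M.star (e s) = e s := by
  rw [← he.mul_one (M.star (e s)), ← M.star_star (M.mul _ _), M.star_mul, M.star_star,
    he.mul_one, M.star_star]

end Algebra

end StarAlgebroid

namespace BStarAlgebroid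

variable {S : Type uS} {A : S → S → Type uA}
  [∀ s t, NormedAddCommGroup (A s t)] [∀ s t, NormedSpace ℂ (A s t)] (𝒜 : BStarAlgebroid S A)

theorem continuous_star {s t : S} : Continuous (𝒜.star : A s t → A t s) := by
  refine (AddMonoidHomClass.isometry_of_norm
    (AddMonoidHom.mk' (𝒜.star (s := s) (t := t)) 𝒜.star_add) fun a => ?_).continuous
  exact 𝒜.norm_star a

/-- If `‖x‖ < 1` and `x` is self-adjoint, then `x = 2 y - y y` for some self-adjoint `y`. -/
theorem exists_quadratic_root {s : S} {x : A s s} (hx : ‖x‖ < 1) (hxs : 𝒜.star x = x) :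
    ∃ y : A s s, 𝒜.star y = y ∧ (2 : ℂ) • y = x + 𝒜.mul y y := by
  have := 𝒜.complete s s
  -- The root is a fixed point of `y ↦ (x + y y)/2`. With `r = ‖x‖ < 1`, the ball of radius `r` is
  -- preserved since `(r + r²)/2 ≤ r`, and `y y - z z = y (y - z) + (y - z) z` gives the contraction
  -- constant `r`. Self-adjointness is a closed condition, built into `Y` so that the limit inherits
  -- it.
  let Y : Set (A s s) := {y | ‖y‖ ≤ ‖x‖ ∧ 𝒜.star y = y}
  let f : A s s → A s s := fun y => (2⁻¹ : ℂ) • (x + 𝒜.mul y y)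
  have hY : IsComplete Y :=
    ((isClosed_le continuous_norm continuous_const).inter
      (isClosed_eq 𝒜.continuous_star continuous_id)).isComplete
  have hf : Set.MapsTo f Y Y := by
    rintro y ⟨hy, hys⟩
    refine ⟨?_, ?_⟩
    · have h1 : ‖x + 𝒜.mul y y‖ ≤ ‖x‖ + ‖y‖ * ‖y‖ :=
        (norm_add_le _ _).trans (by gcongr; exact 𝒜.norm_mul_le y y)
      have h2 : ‖f y‖ = 2⁻¹ * ‖x + 𝒜.mul y y‖ := by
        rw [norm_smul]
        norm_num
      nlinarith [norm_nonneg y]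
    · simp only [f]
      rw [𝒜.star_smul, 𝒜.star_add, 𝒜.star_mul, hxs, hys, map_inv₀, Complex.conj_ofNat]
  have hc : ContractingWith ‖x‖₊ (hf.restrict f Y Y) := by
    refine ⟨by exact_mod_cast hx, LipschitzWith.of_dist_le_mul ?_⟩
    rintro ⟨y, hy, -⟩ ⟨z, hz, -⟩
    simp only [Subtype.dist_eq, Set.MapsTo.val_restrict_apply, dist_eq_norm, coe_nnnorm]
    have h1 : f y - f z = (2⁻¹ : ℂ) • (𝒜.mul y (y - z) + 𝒜.mul (y - z) z) := by
      simp only [f, 𝒜.mul_sub, 𝒜.sub_mul, ← smul_sub]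
      congr 1
      abel
    have h2 : ‖f y - f z‖ = 2⁻¹ * ‖𝒜.mul y (y - z) + 𝒜.mul (y - z) z‖ := by
      rw [h1, norm_smul]
      norm_num
    have h3 := norm_add_le (𝒜.mul y (y - z)) (𝒜.mul (y - z) z)
    have h4 := 𝒜.norm_mul_le y (y - z)
    have h5 := 𝒜.norm_mul_le (y - z) z
    have h6 := mul_le_mul_of_nonneg_right hy (norm_nonneg (y - z))
    have h7 := mul_le_mul_of_nonneg_right hz (norm_nonneg (y - z))
    linarith
  obtain ⟨y, hyY, hy, -⟩ := hc.exists_fixedPoint' hY hf (x := 0)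
    ⟨by simp, 𝒜.star_zero⟩ (edist_ne_top _ _)
  refine ⟨y, hyY.2, ?_⟩
  have hfy : (2⁻¹ : ℂ) • (x + 𝒜.mul y y) = y := hy
  rw [← hfy, smul_smul, hfy]
  simp

/-- If `‖c‖ < 1`, then `e - c* c` is of the form `y* y`. -/
theorem exists_sub_star_mul_self_eq {e : ∀ s, A s s} (he : 𝒜.IsUnit e) {s t : S} {c : A s t}
    (hc : ‖c‖ < 1) : ∃ y : A s s, e s = 𝒜.mul (𝒜.star c) c + 𝒜.mul (𝒜.star y) y := by
  obtain ⟨y, hys, hy⟩ := 𝒜.exists_quadratic_root (x := 𝒜.mul (𝒜.star c) c)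
    (lt_of_le_of_lt (𝒜.norm_mul_le _ _) (by
      rw [𝒜.norm_star]; nlinarith [norm_nonneg c])) (by rw [𝒜.star_mul, 𝒜.star_star])
  -- `(e - y)(e - y) = e - (2 y - y y) = e - c* c`.
  refine ⟨e s - y, ?_⟩
  rw [𝒜.star_sub, he.star_eq, hys, 𝒜.sub_mul, 𝒜.mul_sub, 𝒜.mul_sub, he.one_mul, he.one_mul,
    he.mul_one]
  rw [two_smul] at hy
  have := eq_sub_of_add_eq' hy.symm
  rw [this]
  abel

end BStarAlgebroid

/-! ### Compressions of representations are completely positive -/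

namespace StarAlgebroid

open scoped ComplexOrder

variable {S : Type uS} {A : S → S → Type uA}
  [∀ s t, AddCommGroup (A s t)] [∀ s t, Module ℂ (A s t)] {M : StarAlgebroid S A}
  {X : Type uX} {H : X → Type uH}
  [∀ x, NormedAddCommGroup (H x)] [∀ x, InnerProductSpace ℂ (H x)] [∀ x, CompleteSpace (H x)]

/-- The quadratic form of a sum of matrices `x* x` over `𝓑(𝐇)` is nonnegative. -/
theorem IsPositive.inner_nonneg {n : ℕ} {x : Fin n → X} {b : ∀ i j, H (x j) →L[ℂ] H (x i)}
    (hb : ((boundedOperators H).amplification n).IsPositive (s := x) b) (h : ∀ i, H (x i)) :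
    0 ≤ ∑ i, ∑ j, inner ℂ (h i) (b i j (h j)) := by
  obtain ⟨m, t, y, rfl⟩ := hb
  -- Each row `l` of each `y k`, applied to `h`, contributes the square of a norm.
  have key : ∑ i, ∑ j, inner ℂ (h i) ((∑ k, ((boundedOperators H).amplification n).mul
      (((boundedOperators H).amplification n).star (y k)) (y k)) i j (h j)) =
      ∑ k, ∑ l, inner ℂ (∑ i, y k l i (h i)) (∑ j, y k l j (h j)) := by
    simp only [Finset.sum_apply, sum_inner, inner_sum, amplification, boundedOperators,
      _root_.sum_apply, ContinuousLinearMap.comp_apply,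
      ContinuousLinearMap.adjoint_inner_right]
    rw [Finset.sum_congr rfl fun i _ => Finset.sum_comm, Finset.sum_comm]
    refine Finset.sum_congr rfl fun k _ => ?_
    rw [Finset.sum_congr rfl fun i _ => Finset.sum_comm, Finset.sum_comm]
    exact Finset.sum_congr rfl fun l _ => Finset.sum_comm
  rw [key]
  exact Finset.sum_nonneg fun k _ => Finset.sum_nonneg fun l _ => by
    rw [inner_self_eq_norm_sq_to_K]
    norm_cast
    exact Complex.zero_le_real.2 (sq_nonneg _)

/-- Over `ℂ` a real quadratic form already forces self-adjointness, so `P` is positive in the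
C*-algebra of operators, where positive elements are squares. -/
theorem _root_.ContinuousLinearMap.exists_eq_adjoint_comp_self {E : Type*} [NormedAddCommGroup E]
    [InnerProductSpace ℂ E] [CompleteSpace E] {P : E →L[ℂ] E}
    (hP : ∀ u, 0 ≤ inner ℂ u (P u)) : ∃ Q : E →L[ℂ] E, P = ContinuousLinearMap.adjoint Q ∘L Q := by
  have h0 : 0 ≤ P := by
    rw [ContinuousLinearMap.nonneg_iff_isPositive, ContinuousLinearMap.isPositive_iff_complex]
    intro u
    obtain ⟨h1, h2⟩ := Complex.nonneg_iff.1 (hP u)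
    have h3 : inner ℂ (P u) u = inner ℂ u (P u) := by
      rw [← inner_conj_symm, Complex.conj_eq_iff_im]
      exact h2.symm
    rw [h3]
    exact ⟨Complex.ext (by simp) (by simpa using h2), h1⟩
  exact CStarAlgebra.nonneg_iff_eq_star_mul_self.1 h0

/-- A matrix over `𝓑(𝐇)` with nonnegative quadratic form is of the form `x* x`. -/
theorem isPositive_of_inner_nonneg {n : ℕ} {x : Fin n → X} {b : ∀ i j, H (x j) →L[ℂ] H (x i)}
    (hb : ∀ h : ∀ i, H (x i), 0 ≤ ∑ i, ∑ j, inner ℂ (h i) (b i j (h j))) :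
    ((boundedOperators H).amplification n).IsPositive (s := x) b := by
  classical
  let pr : ∀ i, PiLp 2 (fun i => H (x i)) →L[ℂ] H (x i) :=
    fun i => PiLp.proj 2 (fun i => H (x i)) i
  have hpr : ∀ i h, ContinuousLinearMap.adjoint (pr i) h = WithLp.toLp 2 (Pi.single i h) := by
    intro i h
    refine ext_inner_left ℂ fun v => ?_
    rw [ContinuousLinearMap.adjoint_inner_right, PiLp.inner_apply, Finset.sum_eq_single i]
    · simp [pr]
    · intro k _ hk
      simp [Pi.single_eq_of_ne hk]
    · simp
  -- The matrix `b` becomes a single operator on the Hilbert sum of the `H (x i)`.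
  let P : PiLp 2 (fun i => H (x i)) →L[ℂ] PiLp 2 (fun i => H (x i)) :=
    ∑ i, ∑ j, ContinuousLinearMap.adjoint (pr i) ∘L b i j ∘L pr j
  have hin : ∀ u v, inner ℂ u (P v) = ∑ i, ∑ j, inner ℂ (u i) (b i j (v j)) := fun u v => by
    simp only [P, _root_.sum_apply, inner_sum, ContinuousLinearMap.comp_apply,
      ContinuousLinearMap.adjoint_inner_right]
    rfl
  obtain ⟨Q, hQ⟩ := ContinuousLinearMap.exists_eq_adjoint_comp_self
    (P := P) fun u => by rw [hin]; exact hb u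
  -- One square suffices: the matrix of `Q` with respect to the coordinates of the Hilbert sum.
  refine ⟨1, fun _ => x, fun _ i j => pr i ∘L Q ∘L ContinuousLinearMap.adjoint (pr j), ?_⟩
  funext i j
  ext g
  refine ext_inner_left ℂ fun h => ?_
  have h1 : inner ℂ h (b i j g) = inner ℂ (ContinuousLinearMap.adjoint (pr i) h)
      (P (ContinuousLinearMap.adjoint (pr j) g)) := by
    rw [hin, hpr, hpr, Finset.sum_eq_single i, Finset.sum_eq_single j]
    · simp
    · intro k _ hk
      simp [Pi.single_eq_of_ne hk]
    · simp
    · intro k _ hk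
      simp [Pi.single_eq_of_ne hk]
    · simp
  rw [h1, hQ, ContinuousLinearMap.comp_apply, ContinuousLinearMap.adjoint_inner_right,
    PiLp.inner_apply]
  simp only [Finset.univ_unique, Finset.sum_singleton, amplification, boundedOperators,
    _root_.sum_apply, inner_sum, ContinuousLinearMap.comp_apply,
    ContinuousLinearMap.adjoint_inner_right]
  rfl

variable {τ : S → X} {T : ∀ s t, A s t →ₗ[ℂ] (H (τ s) →L[ℂ] H (τ t))}

theorem IsCompletelyPositive.isPartiallyPosSemidef
    (hT : IsCompletelyPositive M (boundedOperators H) T) : IsPartiallyPosSemidef M T := by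
  intro n s t a h
  rcases n.eq_zero_or_pos with rfl | hn
  · simp
  let o : Fin n := ⟨0, hn⟩
  refine ((hT n).2 t (fun i j => M.mul (M.star (a i)) (a j))
    -- Amplifications contain only square matrices, so the row `(a₁, …, aₙ)` is padded with zero
    -- rows; its position `o` requires `n > 0`.
    ⟨1, fun _ _ => s, fun _ i j => if i = o then a j else 0, ?_⟩).inner_nonneg h
  funext i j
  simp only [Finset.univ_unique, Finset.sum_singleton, amplification]
  rw [Finset.sum_eq_single o]
  · simp
  · intro k _ hk
    simp [hk, M.mul_zero]
  · simp

/-- Applying `Φ` entrywise turns squares into squares, so the form of `[Φ(aᵢⱼ)]` is nonnegative;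
evaluated at the vectors `V hᵢ` it is the form of `[T(aᵢⱼ)]`. -/
theorem Dilation.isCompletelyPositive (D : Dilation.{uS, uA, uX, uH, w} M T)
    (hT : IsHermitianMap M (boundedOperators H) T) :
    IsCompletelyPositive M (boundedOperators H) T := by
  refine fun n => ⟨hT, ?_⟩
  rintro s _ ⟨m, t, y, rfl⟩
  refine isPositive_of_inner_nonneg fun h => ?_
  have hΦ : ((boundedOperators D.K).amplification n).IsPositive (s := fun i => τ (s i))
      (fun i j => D.Φ.map (s j) (s i) ((∑ k, (M.amplification n).mul
        ((M.amplification n).star (y k)) (y k)) i j)) := by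
    refine ⟨m, fun k i => τ (t k i), fun k i j => D.Φ.map _ _ (y k i j), ?_⟩
    funext i j
    simp only [Finset.sum_apply, map_sum, amplification, D.Φ.map_mul, D.Φ.map_star]
  convert hΦ.inner_nonneg (fun i => D.V (s i) (h i)) using 4 with i _ j _
  rw [D.eq_compression, ContinuousLinearMap.comp_apply, ContinuousLinearMap.adjoint_inner_right]
  rfl

end StarAlgebroid

/-! ### Construction of a dilation -/

namespace StarAlgebroid

open scoped ComplexOrder ComplexConjugate

variable {S : Type uS} {A : S → S → Type uA}
  [∀ s t, NormedAddCommGroup (A s t)] [∀ s t, NormedSpace ℂ (A s t)]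
  {X : Type uX} {H : X → Type uH}
  [∀ x, NormedAddCommGroup (H x)] [∀ x, InnerProductSpace ℂ (H x)]
  {τ : S → X}

/-- Pairs of an element with codomain `t` and a vector over its domain. -/
abbrev CyclicIndex (A : S → S → Type uA) (H : X → Type uH) (τ : S → X) (t : S) :
    Type (max uS uA uH) :=
  Σ s : S, A s t × H (τ s)

/-- The kernel `((a, h), (b, k)) ↦ ⟨T(a* b) k, h⟩`. -/
noncomputable def cyclicKernel (M : StarAlgebroid S A)
    (T : ∀ s t, A s t →ₗ[ℂ] (H (τ s) →L[ℂ] H (τ t))) (t : S) (p q : CyclicIndex A H τ t) : ℂ :=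
  inner ℂ p.2.2 (T q.1 p.1 (M.mul (M.star p.2.1) q.2.1) q.2.2)

variable {M : StarAlgebroid S A} {T : ∀ s t, A s t →ₗ[ℂ] (H (τ s) →L[ℂ] H (τ t))}

theorem conj_cyclicKernel [∀ x, CompleteSpace (H x)]
    (hT : IsHermitianMap M (boundedOperators H) T) (t : S)
    (p q : CyclicIndex A H τ t) :
    conj (cyclicKernel M T t p q) = cyclicKernel M T t q p := by
  have h := hT _ _ (M.mul (M.star p.2.1) q.2.1)
  rw [M.star_mul, M.star_star] at h
  simp only [cyclicKernel]
  rw [h, inner_conj_symm]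
  exact (ContinuousLinearMap.adjoint_inner_right _ _ _).symm

theorem IsPartiallyPosSemidef.cyclicKernel_nonneg (hP : IsPartiallyPosSemidef M T) (t : S)
    (z : CyclicIndex A H τ t →₀ ℂ) :
    0 ≤ (z.sum fun p a => z.sum fun q b => conj a * b * cyclicKernel M T t p q).re := by
  let φ : Fin z.support.card ≃ z.support := z.support.equivFin.symm
  -- The support of `z` is enumerated and its coefficients are absorbed into the vectors.
  have h := hP _ t (fun i => (φ i).1.1) (fun i => (φ i).1.2.1) (fun i => z (φ i) • (φ i).1.2.2)
  refine (Complex.nonneg_iff.1 (h.trans_eq ?_)).1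
  simp only [Finsupp.sum]
  rw [← Finset.sum_coe_sort z.support, ← φ.sum_comp]
  refine Finset.sum_congr rfl fun i _ => ?_
  rw [← Finset.sum_coe_sort z.support, ← φ.sum_comp]
  refine Finset.sum_congr rfl fun j _ => ?_
  rw [map_smul, inner_smul_left, inner_smul_right, _root_.mul_assoc]
  rfl

/-- Data consisting of a Hilbert space for each object `t`, generated by vectors `a ⊗ h` with `a`
of codomain `t`, on which the algebroid acts by left multiplication. -/
structure CyclicRep (M : StarAlgebroid S A)
    (T : ∀ s t, A s t →ₗ[ℂ] (H (τ s) →L[ℂ] H (τ t))) where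
  G : S → Type w
  [normedG : ∀ t, NormedAddCommGroup (G t)]
  [innerG : ∀ t, InnerProductSpace ℂ (G t)]
  [completeG : ∀ t, CompleteSpace (G t)]
  vec : ∀ {s t}, A s t → H (τ s) → G t
  inner_vec : ∀ {s r t} (a : A s t) (h : H (τ s)) (b : A r t) (k : H (τ r)),
    inner ℂ (vec a h) (vec b k) = inner ℂ h (T r s (M.mul (M.star a) b) k)
  dense : ∀ t, (Submodule.span ℂ (Set.range fun p : CyclicIndex A H τ t =>
    vec p.2.1 p.2.2)).topologicalClosure = ⊤
  act : ∀ {s t}, A s t → G s →L[ℂ] G t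
  act_vec : ∀ {r s t} (c : A s t) (a : A r s) (h : H (τ r)), act c (vec a h) = vec (M.mul c a) h

attribute [instance] CyclicRep.normedG
attribute [instance] CyclicRep.innerG
attribute [instance] CyclicRep.completeG

/-- The difficulty is the boundedness of left multiplication; this is where the Banach structure of
the fibres enters. -/
theorem _root_.BStarAlgebroid.nonempty_cyclicRep {𝒜 : BStarAlgebroid S A} {e : ∀ s, A s s}
    (he : 𝒜.IsUnit e) [∀ x, CompleteSpace (H x)]
    (hT : IsHermitianMap 𝒜.toStarAlgebroid (boundedOperators H) T)
    (hP : IsPartiallyPosSemidef 𝒜.toStarAlgebroid T) :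
    Nonempty (CyclicRep.{uS, uA, uX, uH, max uS uA uH} 𝒜.toStarAlgebroid T) := by
  let R : ∀ t, GramRealization (cyclicKernel 𝒜.toStarAlgebroid T t) := fun t =>
    (nonempty_gramRealization _ (conj_cyclicKernel hT t) (hP.cyclicKernel_nonneg t)).some
  have hin : ∀ {s r t} (a : A s t) (h : H (τ s)) (b : A r t) (k : H (τ r)),
      inner ℂ ((R t).vec ⟨s, a, h⟩) ((R t).vec ⟨r, b, k⟩) =
        inner ℂ h (T r s (𝒜.mul (𝒜.star a) b) k) := fun a h b k => (R _).inner_vec _ _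
  have hact : ∀ {s t} (c : A s t), ∃ f : (R s).space →L[ℂ] (R t).space,
      ∀ p : CyclicIndex A H τ s, f ((R s).vec p) = (R t).vec ⟨p.1, 𝒜.mul c p.2.1, p.2.2⟩ := by
    intro s t c
    -- Rescaling by `‖c‖ + 1` makes the norm strictly less than `1` and also covers `c = 0`.
    obtain ⟨C, d, hd, hcd⟩ : ∃ (C : ℂ) (d : A s t), ‖d‖ < 1 ∧ c = C • d := by
      have hC : 0 < ‖c‖ + 1 := by positivity
      refine ⟨(‖c‖ + 1 : ℝ), (((‖c‖ + 1 : ℝ) : ℂ)⁻¹) • c, ?_, ?_⟩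
      · rw [norm_smul, norm_inv, Complex.norm_real, Real.norm_of_nonneg hC.le,
          inv_mul_lt_iff₀ hC]
        simp
      · rw [smul_smul, mul_inv_cancel₀ (by exact_mod_cast hC.ne'), one_smul]
    obtain ⟨y, hy⟩ := 𝒜.exists_sub_star_mul_self_eq he hd
    -- Inserting `e = d* d + y* y` gives `a* b = (d a)* (d b) + (y a)* (y b)`. Norms squared split
    -- accordingly, so left multiplication by `d` is a contraction.
    have hgram := HilbertFamily.norm_sq_linearCombination_of_gram_add
      (v := (R s).vec) (w := fun p => (R t).vec ⟨p.1, 𝒜.mul d p.2.1, p.2.2⟩)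
      (u := fun p => (R s).vec ⟨p.1, 𝒜.mul y p.2.1, p.2.2⟩) (by
        rintro ⟨r, a, h⟩ ⟨r', b, k⟩
        have : 𝒜.mul (𝒜.star a) b = 𝒜.mul (𝒜.star (𝒜.mul d a)) (𝒜.mul d b) +
            𝒜.mul (𝒜.star (𝒜.mul y a)) (𝒜.mul y b) := by
          rw [𝒜.star_mul, 𝒜.star_mul, ← 𝒜.mul_assoc, ← 𝒜.mul_assoc, 𝒜.mul_assoc (𝒜.star d),
            𝒜.mul_assoc (𝒜.star y), ← 𝒜.mul_add, ← 𝒜.add_mul, ← hy, he.one_mul]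
        simp only [hin]
        rw [this, map_add, _root_.add_apply, inner_add_right])
    obtain ⟨f, hf⟩ := HilbertFamily.exists_clm (R s).dense
      (w := fun p => (R t).vec ⟨p.1, 𝒜.mul d p.2.1, p.2.2⟩) (C := 1) (fun z => by
        rw [one_mul, ← sq_le_sq₀ (norm_nonneg _) (norm_nonneg _), hgram z]
        exact le_add_of_nonneg_right (sq_nonneg _))
    refine ⟨C • f, fun p => ?_⟩
    rw [_root_.smul_apply, hf]
    refine HilbertFamily.eq_of_inner (R t).dense ?_
    rintro ⟨r, a, h⟩
    rw [inner_smul_right, hin, hin, hcd, 𝒜.smul_mul, 𝒜.mul_smul, map_smul,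
      _root_.smul_apply, inner_smul_right]
  choose act hact using @hact
  exact ⟨{
    G := fun t => (R t).space
    vec := fun a h => (R _).vec ⟨_, a, h⟩
    inner_vec := hin
    dense := fun t => (R t).dense
    act := act
    act_vec := fun c a h => hact c ⟨_, a, h⟩ }⟩

namespace CyclicRep

variable (R : CyclicRep.{uS, uA, uX, uH, w} M T)

theorem ext_vec {F : Type*} [NormedAddCommGroup F] [InnerProductSpace ℂ F] {t : S}
    {f g : R.G t →L[ℂ] F} (h : ∀ (s : S) (a : A s t) (k : H (τ s)), f (R.vec a k) = g (R.vec a k)) :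
    f = g :=
  HilbertFamily.clm_ext (R.dense t) fun p => h p.1 p.2.1 p.2.2

theorem eq_of_inner_vec {t : S} {x y : R.G t}
    (h : ∀ (s : S) (a : A s t) (k : H (τ s)), inner ℂ (R.vec a k) x = inner ℂ (R.vec a k) y) :
    x = y :=
  HilbertFamily.eq_of_inner (R.dense t) fun p => h p.1 p.2.1 p.2.2

/-- Linearity of `vec` and `act` is not part of the data of `CyclicRep`; the inner product formula
and density force it. -/
theorem vec_add_left {s t : S} (a b : A s t) (h : H (τ s)) :
    R.vec (a + b) h = R.vec a h + R.vec b h :=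
  R.eq_of_inner_vec fun r c k => by
    rw [inner_add_right, R.inner_vec, R.inner_vec, R.inner_vec, M.mul_add, map_add,
      _root_.add_apply, inner_add_right]

theorem vec_smul_left {s t : S} (z : ℂ) (a : A s t) (h : H (τ s)) :
    R.vec (z • a) h = z • R.vec a h :=
  R.eq_of_inner_vec fun r c k => by
    rw [inner_smul_right, R.inner_vec, R.inner_vec, M.mul_smul, map_smul,
      _root_.smul_apply, inner_smul_right]

theorem vec_add_right {s t : S} (a : A s t) (h k : H (τ s)) :
    R.vec a (h + k) = R.vec a h + R.vec a k :=
  R.eq_of_inner_vec fun r c l => by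
    rw [inner_add_right, R.inner_vec, R.inner_vec, R.inner_vec, map_add, inner_add_right]

theorem vec_smul_right {s t : S} (z : ℂ) (a : A s t) (h : H (τ s)) :
    R.vec a (z • h) = z • R.vec a h :=
  R.eq_of_inner_vec fun r c l => by
    rw [inner_smul_right, R.inner_vec, R.inner_vec, map_smul, inner_smul_right]

theorem act_add {s t : S} (a b : A s t) : R.act (a + b) = R.act a + R.act b :=
  R.ext_vec fun r c k => by
    rw [_root_.add_apply, R.act_vec, R.act_vec, R.act_vec, M.add_mul, R.vec_add_left]

theorem act_smul {s t : S} (z : ℂ) (a : A s t) : R.act (z • a) = z • R.act a :=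
  R.ext_vec fun r c k => by
    rw [_root_.smul_apply, R.act_vec, R.act_vec, M.smul_mul, R.vec_smul_left]

theorem act_mul {s u t : S} (a : A u t) (b : A s u) : R.act (M.mul a b) = R.act a ∘L R.act b :=
  R.ext_vec fun r c k => by
    rw [ContinuousLinearMap.comp_apply, R.act_vec, R.act_vec, R.act_vec, M.mul_assoc]

theorem act_star {s t : S} (a : A s t) :
    R.act (M.star a) = ContinuousLinearMap.adjoint (R.act a) :=
  R.ext_vec fun r c k => R.eq_of_inner_vec fun q b h => by
    rw [ContinuousLinearMap.adjoint_inner_right, R.act_vec, R.act_vec, R.inner_vec, R.inner_vec,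
      M.star_mul, M.mul_assoc]

/-- The operator `h ↦ a ⊗ h`. -/
noncomputable def vecCLM {s t : S} (a : A s t) : H (τ s) →L[ℂ] R.G t :=
  LinearMap.mkContinuous
    { toFun := R.vec a
      map_add' := R.vec_add_right a
      map_smul' := fun z h => R.vec_smul_right z a h }
    -- The constant comes from `‖a ⊗ h‖² = ⟨T(a* a) h, h⟩`.
    (Real.sqrt ‖T s s (M.mul (M.star a) a)‖) fun h => by
      refine (sq_le_sq₀ (norm_nonneg _) (by positivity)).1 ?_
      rw [mul_pow, Real.sq_sqrt (norm_nonneg _), norm_sq_eq_re_inner (𝕜 := ℂ)]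
      change RCLike.re (inner ℂ (R.vec a h) (R.vec a h)) ≤ _
      rw [R.inner_vec]
      refine (RCLike.re_le_norm _).trans ((norm_inner_le_norm _ _).trans ?_)
      rw [pow_two, mul_comm, ← _root_.mul_assoc]
      gcongr
      exact ContinuousLinearMap.le_opNorm _ _

@[simp]
theorem vecCLM_apply {s t : S} (a : A s t) (h : H (τ s)) : R.vecCLM a h = R.vec a h := rfl

/-! ### Hilbert sums over the fibres of `τ` and the resulting dilation -/

/-- The Hilbert sum of the spaces over the objects in the fibre of `τ` over `x`. -/
abbrev bundle (x : X) : Type (max uS w) := lp (fun t : {t : S // τ t = x} => R.G t) 2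

open Classical in
/-- The inclusion of a summand. -/
noncomputable def incl (x : X) (t : {t : S // τ t = x}) : R.G t →L[ℂ] R.bundle x :=
  lp.singleContinuousLinearMap ℂ (fun t : {t : S // τ t = x} => R.G t) 2 t

theorem inner_incl_left {x : X} (t : {t : S // τ t = x}) (g : R.G t) (k : R.bundle x) :
    inner ℂ (R.incl x t g) k = inner ℂ g (k t) := by
  classical
  exact lp.inner_single_left (𝕜 := ℂ) (G := fun t : {t : S // τ t = x} => R.G t) t g k

theorem incl_apply_self {x : X} (t : {t : S // τ t = x}) (g : R.G t) : R.incl x t g t = g := by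
  classical
  exact lp.single_apply_self (E := fun t : {t : S // τ t = x} => R.G t) 2 t g

theorem incl_apply_ne {x : X} {t u : {t : S // τ t = x}} (h : u ≠ t) (g : R.G t) :
    R.incl x t g u = 0 := by
  classical
  exact lp.single_apply_ne (E := fun t : {t : S // τ t = x} => R.G t) 2 t g h

theorem adjoint_incl_apply {x : X} (t : {t : S // τ t = x}) (k : R.bundle x) :
    ContinuousLinearMap.adjoint (R.incl x t) k = k t :=
  ext_inner_left ℂ fun g => by
    rw [ContinuousLinearMap.adjoint_inner_right, R.inner_incl_left]

theorem adjoint_incl_incl {x : X} (t : {t : S // τ t = x}) (g : R.G t) :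
    ContinuousLinearMap.adjoint (R.incl x t) (R.incl x t g) = g := by
  rw [R.adjoint_incl_apply, R.incl_apply_self]

/-- The inclusion of the space over `t` into the Hilbert sum over `τ t`. -/
noncomputable def emb (t : S) : R.G t →L[ℂ] R.bundle (τ t) := R.incl (τ t) ⟨t, rfl⟩

theorem adjoint_emb_emb (t : S) (g : R.G t) :
    ContinuousLinearMap.adjoint (R.emb t) (R.emb t g) = g :=
  R.adjoint_incl_incl ⟨t, rfl⟩ g

/-- Removes transports between equal fibres: `incl` is defined over every `x`, while `emb` lives
only over `τ t`. -/
theorem fibreCast_emb {t : S} {x : X} (h : τ t = x) (g : R.G t) :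
    Dilation.fibreCast R.bundle h (R.emb t g) = R.incl x ⟨t, h⟩ g := by
  subst h
  rfl

/-- The `*`-representation on the Hilbert sums in which an element `a` from `s` to `t` maps the
summand of `s` to that of `t` by left multiplication and annihilates the other summands. -/
noncomputable def rep : StarMorphism M (boundedOperators R.bundle) τ where
  map s t :=
    { toFun := fun a => R.emb t ∘L R.act a ∘L ContinuousLinearMap.adjoint (R.emb s)
      map_add' := fun a b => by
        rw [R.act_add, ContinuousLinearMap.add_comp, ContinuousLinearMap.comp_add]
      map_smul' := fun z a => by
        rw [R.act_smul, ContinuousLinearMap.smul_comp, ContinuousLinearMap.comp_smul]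
        rfl }
  map_mul {s u t} a b := by
    ext1 k
    simp [boundedOperators, R.act_mul, R.adjoint_emb_emb]
  map_star {s t} a := by
    simp [boundedOperators, R.act_star, ContinuousLinearMap.adjoint_comp,
      ContinuousLinearMap.comp_assoc]

/-- The dilation obtained from a cyclic representation. -/
noncomputable def dilation [∀ x, CompleteSpace (H x)] {e : ∀ s, A s s} (he : M.IsUnit e) :
    Dilation.{uS, uA, uX, uH, max uS w} M T where
  K := R.bundle
  V s := R.emb s ∘L R.vecCLM (e s)
  Φ := R.rep
  eq_compression s t a := by
    ext h
    -- The compression is tested through `⟨e_t ⊗ k, a ⊗ h⟩ = ⟨k, T(e_t* a) h⟩`.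
    refine ext_inner_left ℂ fun k => ?_
    change _ = inner ℂ k (ContinuousLinearMap.adjoint (R.emb t ∘L R.vecCLM (e t))
      (R.emb t (R.act a (ContinuousLinearMap.adjoint (R.emb s) (R.emb s (R.vec (e s) h))))))
    rw [R.adjoint_emb_emb, ContinuousLinearMap.adjoint_comp, ContinuousLinearMap.comp_apply,
      R.adjoint_emb_emb, ContinuousLinearMap.adjoint_inner_right, vecCLM_apply, R.act_vec,
      R.inner_vec, he.star_eq, he.one_mul, he.mul_one]

variable [∀ x, CompleteSpace (H x)] {e : ∀ s, A s s} (he : M.IsUnit e)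

theorem dilation_op_apply {s t : S} (a : A s t) (k : (R.dilation he).K (τ s)) :
    (R.dilation he).op a k =
      R.emb t (R.act a (ContinuousLinearMap.adjoint (R.emb s) k)) := rfl

theorem dilation_op_apply_V {s t : S} (a : A s t) (h : H (τ s)) :
    (R.dilation he).op a ((R.dilation he).V s h) = R.emb t (R.vec a h) := by
  change R.emb t (R.act a (ContinuousLinearMap.adjoint (R.emb s) (R.emb s (R.vec (e s) h)))) = _
  rw [R.adjoint_emb_emb, R.act_vec, he.mul_one]

theorem dilation_isUnitSupported : (R.dilation he).IsUnitSupported e :=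
  fun _ h => R.dilation_op_apply_V he _ h

theorem dilation_isOrthogonal : (R.dilation he).IsOrthogonal := by
  intro u v s t a b hne hst k l
  rw [dilation_op_apply, dilation_op_apply]
  generalize R.act a _ = g
  generalize R.act b _ = g'
  change inner ℂ (Dilation.fibreCast R.bundle hst (R.emb s g)) (R.emb t g') = 0
  rw [R.fibreCast_emb, R.inner_incl_left, emb, R.incl_apply_ne, inner_zero_right]
  simpa using hne

/-- Each coordinate of a vector orthogonal to all generators is orthogonal to the dense family `a ⊗
h` of its summand, hence zero. -/
theorem dilation_isMinimal : (R.dilation he).IsMinimal := by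
  intro x
  rw [← Submodule.orthogonal_eq_bot_iff, Submodule.eq_bot_iff]
  intro k hk
  change k = (0 : R.bundle x)
  refine lp.ext (funext fun t => ?_)
  refine R.eq_of_inner_vec fun s a h => ?_
  refine Eq.trans ?_ (inner_zero_right _).symm
  refine (R.inner_incl_left t (R.vec a h) k).symm.trans ?_
  refine (Submodule.mem_orthogonal _ _).1 hk _
    (Submodule.le_topologicalClosure _ (Submodule.subset_span ?_))
  refine ⟨s, t, t.2, a, h, ?_⟩
  rw [R.dilation_op_apply_V he]
  exact (R.fibreCast_emb t.2 _).symm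

end CyclicRep

end StarAlgebroid

/-! ### Uniqueness of minimal orthogonal dilations -/

namespace StarAlgebroid.Dilation

variable {S : Type uS} {A : S → S → Type uA}
  [∀ s t, AddCommGroup (A s t)] [∀ s t, Module ℂ (A s t)]
  {X : Type uX} {H : X → Type uH}
  [∀ x, NormedAddCommGroup (H x)] [∀ x, InnerProductSpace ℂ (H x)] [∀ x, CompleteSpace (H x)]
  {M : StarAlgebroid S A} {τ : S → X} {T : ∀ s t, A s t →ₗ[ℂ] (H (τ s) →L[ℂ] H (τ t))}

theorem op_mul (D : Dilation.{uS, uA, uX, uH, w} M T) {s u t : S} (a : A u t) (b : A s u)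
    (k : D.K (τ s)) : D.op (M.mul a b) k = D.op a (D.op b k) :=
  congrArg (fun f : D.K (τ s) →L[ℂ] D.K (τ t) => f k) (D.Φ.map_mul a b)

theorem inner_op_left (D : Dilation.{uS, uA, uX, uH, w} M T) {s t : S} (a : A s t)
    (k : D.K (τ s)) (l : D.K (τ t)) :
    inner ℂ (D.op a k) l = inner ℂ k (D.op (M.star a) l) := by
  have h : D.op (M.star a) = ContinuousLinearMap.adjoint (D.op a) := D.Φ.map_star a
  rw [h, ContinuousLinearMap.adjoint_inner_right]

/-- For a common codomain the Gram matrix of the generators depends on `T` alone. -/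
theorem inner_op_V (D : Dilation.{uS, uA, uX, uH, w} M T) {s r t : S} (a : A s t) (b : A r t)
    (h : H (τ s)) (k : H (τ r)) :
    inner ℂ (D.op a (D.V s h)) (D.op b (D.V r k)) =
      inner ℂ h (T r s (M.mul (M.star a) b) k) := by
  rw [D.inner_op_left, ← D.op_mul, D.eq_compression, ContinuousLinearMap.comp_apply,
    ContinuousLinearMap.adjoint_inner_right, ContinuousLinearMap.comp_apply]

/-- The index set of the canonical generators of the fibre of a dilation over `x`. -/
abbrev GenIndex (A : S → S → Type uA) (H : X → Type uH) (τ : S → X) (x : X) :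
    Type (max uS uA uH) :=
  Σ (t : {t : S // τ t = x}) (s : S), A s t × H (τ s)

/-- The canonical generators of the fibre of a dilation over `x`. -/
noncomputable def gen (D : Dilation.{uS, uA, uX, uH, w} M T) (x : X) (p : GenIndex A H τ x) :
    D.K x :=
  fibreCast D.K p.1.2 (D.op p.2.2.1 (D.V p.2.1 p.2.2.2))

theorem IsMinimal.span_gen {D : Dilation.{uS, uA, uX, uH, w} M T} (hD : D.IsMinimal) (x : X) :
    (Submodule.span ℂ (Set.range (D.gen x))).topologicalClosure = ⊤ := by
  rw [← hD x]
  congr 2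
  ext v
  constructor
  · rintro ⟨⟨⟨t, hx⟩, s, a, h⟩, rfl⟩
    exact ⟨s, t, hx, a, h, rfl⟩
  · rintro ⟨s, t, hx, a, h, rfl⟩
    exact ⟨⟨⟨t, hx⟩, s, a, h⟩, rfl⟩

theorem IsOrthogonal.inner_gen_of_ne {D : Dilation.{uS, uA, uX, uH, w} M T} (hD : D.IsOrthogonal)
    {x : X} {p q : GenIndex A H τ x} (hpq : p.1 ≠ q.1) :
    inner ℂ (D.gen x p) (D.gen x q) = 0 := by
  obtain ⟨⟨t, rfl⟩, s, a, h⟩ := p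
  obtain ⟨⟨u, hu⟩, r, b, k⟩ := q
  rw [← inner_conj_symm, map_eq_zero]
  exact hD _ _ _ _ b a (fun h => hpq (Subtype.ext h.symm)) hu _ _

theorem inner_gen_eq {D : Dilation.{uS, uA, uX, uH, w} M T}
    {D' : Dilation.{uS, uA, uX, uH, w'} M T} (hD : D.IsOrthogonal) (hD' : D'.IsOrthogonal)
    {x : X} (p q : GenIndex A H τ x) :
    inner ℂ (D.gen x p) (D.gen x q) = inner ℂ (D'.gen x p) (D'.gen x q) := by
  by_cases hpq : p.1 = q.1
  · obtain ⟨⟨t, rfl⟩, s, a, h⟩ := p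
    obtain ⟨⟨u, hu⟩, r, b, k⟩ := q
    obtain rfl : t = u := congrArg Subtype.val hpq
    exact (D.inner_op_V a b h k).trans (D'.inner_op_V a b h k).symm
  · rw [hD.inner_gen_of_ne hpq, hD'.inner_gen_of_ne hpq]

theorem op_gen_self (D : Dilation.{uS, uA, uX, uH, w} M T) {r s t : S} (a : A s t) (b : A r s)
    (h : H (τ r)) :
    D.op a (D.gen (τ s) ⟨⟨s, rfl⟩, r, b, h⟩) = D.gen (τ t) ⟨⟨t, rfl⟩, r, M.mul a b, h⟩ :=
  (D.op_mul a b _).symm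

/-- In `⟨Φ(a) g, l⟩ = ⟨g, Φ(a*) l⟩` the element `a*` has codomain `s`, while the generator `g` comes
from another object over `τ s`. -/
theorem IsOrthogonal.op_gen_of_ne {D : Dilation.{uS, uA, uX, uH, w} M T} (hD : D.IsOrthogonal)
    {s t : S} (a : A s t) (p : GenIndex A H τ (τ s)) (hp : p.1.1 ≠ s) :
    D.op a (D.gen (τ s) p) = 0 := by
  refine ext_inner_right ℂ fun l => ?_
  rw [D.inner_op_left, inner_zero_left]
  exact hD _ _ _ _ _ _ hp p.1.2 _ _

/-- Minimal orthogonal dilations are intertwined by unitaries that match the canonical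
generators. -/
theorem exists_intertwines {D : Dilation.{uS, uA, uX, uH, w} M T}
    {D' : Dilation.{uS, uA, uX, uH, w'} M T} (hD : D.IsOrthogonal) (hDm : D.IsMinimal)
    (hD' : D'.IsOrthogonal) (hDm' : D'.IsMinimal) :
    ∃ U : ∀ x, D.K x ≃ₗᵢ[ℂ] D'.K x, D.Intertwines D' U ∧
      ∀ (s t : S) (a : A s t) (h : H (τ s)),
        U (τ t) (D.op a (D.V s h)) = D'.op a (D'.V s h) := by
  choose U hU using fun x => HilbertFamily.exists_unitary (hDm.span_gen x) (hDm'.span_gen x)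
    (inner_gen_eq hD hD')
  refine ⟨U, fun s t a k => ?_, fun s t a h => hU (τ t) ⟨⟨t, rfl⟩, s, a, h⟩⟩
  let f : D.K (τ s) →L[ℂ] D'.K (τ t) :=
    (U (τ t)).toContinuousLinearEquiv.toContinuousLinearMap ∘L D.op a
  let g : D.K (τ s) →L[ℂ] D'.K (τ t) :=
    D'.op a ∘L (U (τ s)).toContinuousLinearEquiv.toContinuousLinearMap
  suffices h : f = g from congrArg (fun f => f k) h
  refine HilbertFamily.clm_ext (hDm.span_gen (τ s)) fun p => ?_
  change U (τ t) (D.op a (D.gen (τ s) p)) = D'.op a (U (τ s) (D.gen (τ s) p))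
  rw [hU]
  -- On generators from the object `s`, both representations multiply the index by `a`; on all
  -- others both sides vanish.
  by_cases hp : p.1.1 = s
  · obtain ⟨⟨u, hu⟩, r, b, h⟩ := p
    obtain rfl : u = s := hp
    rw [op_gen_self, op_gen_self, hU]
  · rw [hD.op_gen_of_ne a p hp, hD'.op_gen_of_ne a p hp, map_zero]

/-- If `τ` is injective, minimal dilations are unit-supported. -/
theorem IsMinimal.isUnitSupported {D : Dilation.{uS, uA, uX, uH, w} M T} (hD : D.IsMinimal)
    {e : ∀ s, A s s} (he : M.IsUnit e) (hτ : Function.Injective τ) : D.IsUnitSupported e := by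
  intro s h
  -- For injective `τ`, all generators over `τ s` have codomain `s`, so `Φ(e_s)` fixes a dense span.
  have : D.op (e s) = ContinuousLinearMap.id ℂ (D.K (τ s)) := by
    refine HilbertFamily.clm_ext (hD.span_gen (τ s)) ?_
    rintro ⟨⟨u, hu⟩, r, b, h⟩
    obtain rfl : u = s := hτ hu
    rw [op_gen_self, he.one_mul]
    rfl
  rw [this]
  rfl

end StarAlgebroid.Dilation

theorem theorem5p17 {S : Type uS} {A : S → S → Type uA}
    [∀ s t, NormedAddCommGroup (A s t)] [∀ s t, NormedSpace ℂ (A s t)]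
    (𝒜 : BStarAlgebroid S A) (e : ∀ s, A s s) (he : 𝒜.IsUnit e)
    {X : Type uX} {H : X → Type uH}
    [∀ x, NormedAddCommGroup (H x)] [∀ x, InnerProductSpace ℂ (H x)] [∀ x, CompleteSpace (H x)]
    (τ : S → X) (T : ∀ s t, A s t →ₗ[ℂ] (H (τ s) →L[ℂ] H (τ t)))
    (hT : StarAlgebroid.IsHermitianMap 𝒜.toStarAlgebroid (StarAlgebroid.boundedOperators H) T) :
    List.TFAE [
      StarAlgebroid.IsCompletelyPositive 𝒜.toStarAlgebroid (StarAlgebroid.boundedOperators H) T,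
      StarAlgebroid.IsPartiallyPosSemidef 𝒜.toStarAlgebroid T,
      Nonempty (StarAlgebroid.Dilation.{uS, uA, uX, uH, max uS uA uH} 𝒜.toStarAlgebroid T)] ∧
    (∀ _ : StarAlgebroid.Dilation.{uS, uA, uX, uH, w} 𝒜.toStarAlgebroid T,
      ∃ D : StarAlgebroid.Dilation.{uS, uA, uX, uH, max uS uA uH} 𝒜.toStarAlgebroid T,
        D.IsOrthogonal ∧ D.IsMinimal ∧ D.IsUnitSupported e) ∧
    (∀ (D : StarAlgebroid.Dilation.{uS, uA, uX, uH, w} 𝒜.toStarAlgebroid T)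
      (D' : StarAlgebroid.Dilation.{uS, uA, uX, uH, w'} 𝒜.toStarAlgebroid T),
      D.IsOrthogonal → D.IsMinimal → D'.IsOrthogonal → D'.IsMinimal →
        (∃ U : ∀ x, D.K x ≃ₗᵢ[ℂ] D'.K x, D.Intertwines D' U ∧
          ∀ (s : S) (h : H (τ s)),
            U (τ s) (D.op (e s) (D.V s h)) = D'.op (e s) (D'.V s h)) ∧
        (D.IsUnitSupported e → D'.IsUnitSupported e → D.UnitarilyEquivalent D') ∧
        (Function.Injective τ → D.UnitarilyEquivalent D')) := by
  have hCP : StarAlgebroid.IsPartiallyPosSemidef 𝒜.toStarAlgebroid T →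
      ∃ D : StarAlgebroid.Dilation.{uS, uA, uX, uH, max uS uA uH} 𝒜.toStarAlgebroid T,
        D.IsOrthogonal ∧ D.IsMinimal ∧ D.IsUnitSupported e := by
    intro hP
    obtain ⟨R⟩ := BStarAlgebroid.nonempty_cyclicRep he hT hP
    exact ⟨R.dilation he, R.dilation_isOrthogonal he, R.dilation_isMinimal he,
      R.dilation_isUnitSupported he⟩
  -- The given dilation is used only to derive (2), so its universe is independent of that of the
  -- new one.
  refine ⟨?_, fun D => hCP (D.isCompletelyPositive hT).isPartiallyPosSemidef, ?_⟩
  · tfae_have 1 → 2 := fun h => h.isPartiallyPosSemidef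
    tfae_have 2 → 3 := fun h => ⟨(hCP h).choose⟩
    tfae_have 3 → 1 := fun ⟨D⟩ => D.isCompletelyPositive hT
    tfae_finish
  · intro D D' hD hDm hD' hDm'
    obtain ⟨U, hU, hV⟩ := StarAlgebroid.Dilation.exists_intertwines hD hDm hD' hDm'
    have key : D.IsUnitSupported e → D'.IsUnitSupported e → D.UnitarilyEquivalent D' :=
      -- Unit support makes `V_s k = Φ(e_s) V_s k` itself a generator, and `U` matches generators.
      fun h h' => ⟨U, hU, fun s k => by rw [← h s k, hV, h' s k]⟩
    exact ⟨⟨U, hU, fun s h => hV s s (e s) h⟩, key, fun hτ =>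
      key (hDm.isUnitSupported he hτ) (hDm'.isUnitSupported he hτ)⟩
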